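/- Let $\Gamma$ be a discrete group acting by homeomorphisms on a compact Hausdorff space $X$, and let $D$ be an (algebraic, not necessarily closed) ideal of $\ell^\infty(\Gamma)$ that is invariant under left and right translations by $\Gamma$. Let $C_c(X\rtimes\Gamma)$ be the convolution $*$-algebra of finite formal sums $\sum_s f_s s$ with $f_s\in C(X)$, where $sfs^{-1}=f(s^{-1}\,\cdot\,)$ and $s^*=s^{-1}$. A unital $*$-representation $\pi\colon C_c(X\rtimes\Gamma)\to\mathbb B(\mathcal H)$ on a Hilbert space is called a $D$-representation if there is a dense linear subspace $\mathcal H_0\subset\mathcal H$ such that the function $s\mapsto\langle\pi(s)\xi,\eta\rangle$ belongs to $D$ for all $\xi,\eta\in\mathcal H_0$. Let $C^*(X\rtimes\Gamma)$ (the full crossed product) and $C^*_D(X\rtimes\Gamma)$ (the ideal completion) be the Hausdorff completions of $C_c(X\rtimes\Gamma)$ with respect to $a\mapsto\sup_\pi\|\pi(a)\|$, where $\pi$ ranges over all unital $*$-representations, respectively over all $D$-representations. A function $h\colon X\times\Gamma\to\mathbb C$ is positive definite if for all $s_1,\dots,s_n\in\Gamma$ and $x\in X$ the matrix $[h(s_i.x,\,s_is_j^{-1})]_{i,j}$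 is positive semidefinite. Suppose that there is a sequence of continuous positive definite functions $h_n\colon X\times\Gamma\to\mathbb C$ such that $h_n\to1$ uniformly on compact subsets of $X\times\Gamma$ and such that for each $n$ the function $s\mapsto\sup_{x\in X}|h_n(x,s)|$ belongs to $D$. Then $C^*(X\rtimes\Gamma)=C^*_D(X\rtimes\Gamma)$; that is, the identity map of $C_c(X\rtimes\Gamma)$ induces an isometric $*$-isomorphism $C^*(X\rtimes\Gamma)\to C^*_D(X\rtimes\Gamma)$. -/

import Mathlib

open Filter Topology
open scoped ENNReal ComplexOrder

set_option linter.unusedSectionVars false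

noncomputable section

namespace CrossedProduct

universe u v w

/-! ### The algebraic crossed product -/

section Algebra

variable {X : Type u} {Γ : Type v} [TopologicalSpace X] [Group Γ] [MulAction Γ X]
  [ContinuousConstSMul Γ X]

/-- The action of `Γ` on `C(X)` induced by an action on `X` by homeomorphisms:
`(s • f) x = f (s⁻¹ • x)`. -/
instance actionOnFunctions : MulSemiringAction Γ C(X, ℂ) where
  smul s f := ⟨fun x => f (s⁻¹ • x), by fun_prop⟩
  one_smul f := by
    ext x
    change f ((1 : Γ)⁻¹ • x) = f x
    simp
  mul_smul s t f := by
    ext x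
    change f ((s * t)⁻¹ • x) = f (t⁻¹ • s⁻¹ • x)
    rw [mul_inv_rev, mul_smul]
  smul_zero _ := rfl
  smul_add _ _ _ := rfl
  smul_one _ := rfl
  smul_mul _ _ _ := rfl

theorem action_apply (s : Γ) (f : C(X, ℂ)) (x : X) : (s • f) x = f (s⁻¹ • x) := rfl

instance action_smulCommClass : SMulCommClass Γ ℂ C(X, ℂ) := ⟨fun _ _ _ => rfl⟩

theorem action_star (s : Γ) (f : C(X, ℂ)) : s • star f = star (s • f) := rfl

variable (X Γ) in
/-- The convolution algebra `C_c(X ⋊ Γ)`: finite formal sums `∑ f_s s` with `f_s ∈ C(X)` and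
product determined by `(f s) (g t) = f (s • g) (s t)`. -/
def ConvAlg : Type (max u v) := SkewMonoidAlgebra C(X, ℂ) Γ

namespace ConvAlg

instance instRing : Ring (ConvAlg X Γ) :=
  inferInstanceAs (Ring (SkewMonoidAlgebra C(X, ℂ) Γ))

instance instAlgebra : Algebra ℂ (ConvAlg X Γ) :=
  inferInstanceAs (Algebra ℂ (SkewMonoidAlgebra C(X, ℂ) Γ))

/-- The coefficient functions of an element `∑ f_s s`. -/
def coeff (a : ConvAlg X Γ) : Γ →₀ C(X, ℂ) := SkewMonoidAlgebra.coeff a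

/-- The element `f s`. -/
def single (s : Γ) : C(X, ℂ) →+ ConvAlg X Γ := SkewMonoidAlgebra.singleAddHom s

theorem one_eq : (1 : ConvAlg X Γ) = single 1 1 := rfl

theorem single_mul_single (s t : Γ) (f g : C(X, ℂ)) :
    (single s f * single t g : ConvAlg X Γ) = single (s * t) (f * s • g) :=
  SkewMonoidAlgebra.single_mul_single

theorem smul_single (c : ℂ) (s : Γ) (f : C(X, ℂ)) :
    c • (single s f : ConvAlg X Γ) = single s (c • f) :=
  SkewMonoidAlgebra.smul_single c s f

theorem induction_single {p : ConvAlg X Γ → Prop} (a : ConvAlg X Γ)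
    (single : ∀ s f, p (single s f)) (add : ∀ a b, p a → p b → p (a + b)) : p a :=
  SkewMonoidAlgebra.induction_on' a single add

theorem coeff_add (a b : ConvAlg X Γ) : (a + b).coeff = a.coeff + b.coeff :=
  SkewMonoidAlgebra.coeff_add a b

theorem action_mul (s : Γ) (f g : C(X, ℂ)) : s • (f * g) = s • f * s • g := rfl

theorem action_one (s : Γ) : s • (1 : C(X, ℂ)) = 1 := rfl

theorem action_zero (s : Γ) : s • (0 : C(X, ℂ)) = 0 := rfl

/-- The involution `(∑ f_s s)^* = ∑ s⁻¹ (f_s)^* = ∑ (s⁻¹ • (f_s)^*) s⁻¹`, as an additive map. -/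
def starHom : ConvAlg X Γ →+ ConvAlg X Γ where
  toFun a := a.coeff.sum fun s f => single s⁻¹ (s⁻¹ • star f)
  map_zero' := Finsupp.sum_zero_index (h := fun s f => single s⁻¹ (s⁻¹ • star f))
  map_add' a b := by
    rw [coeff_add]
    refine Finsupp.sum_add_index' (f := a.coeff) (g := b.coeff)
      (h := fun s f => single s⁻¹ (s⁻¹ • star f)) ?_ ?_
    · intro s; rw [star_zero, action_zero, map_zero]
    · intro s f g; rw [star_add, smul_add, map_add]

theorem starHom_single (s : Γ) (f : C(X, ℂ)) :
    starHom (single s f : ConvAlg X Γ) = single s⁻¹ (s⁻¹ • star f) := by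
  refine Finsupp.sum_single_index (h := fun s f => single s⁻¹ (s⁻¹ • star f)) ?_
  rw [star_zero, action_zero, map_zero]

instance instStarRing : StarRing (ConvAlg X Γ) where
  star a := starHom a
  star_involutive a := by
    change starHom (starHom a) = a
    induction a using induction_single with
    | add a b ha hb => rw [map_add, map_add, ha, hb]
    | single s f =>
      rw [starHom_single, starHom_single, ← action_star, star_star, smul_smul, inv_inv,
        mul_inv_cancel, one_smul]
  star_mul a b := by
    change starHom (a * b) = starHom b * starHom a
    induction a using induction_single with
    | add a a' ha ha' => rw [add_mul, map_add, map_add, ha, ha', mul_add]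
    | single s f =>
      induction b using induction_single with
      | add b b' hb hb' => rw [mul_add, map_add, map_add, hb, hb', add_mul]
      | single t g =>
        rw [single_mul_single, starHom_single, starHom_single, starHom_single,
          single_mul_single, mul_inv_rev, star_mul, action_mul, ← action_star, smul_smul,
          smul_smul, inv_mul_cancel_right]
  star_add a b := starHom.map_add a b

theorem star_single (s : Γ) (f : C(X, ℂ)) :
    star (single s f : ConvAlg X Γ) = single s⁻¹ (s⁻¹ • star f) := starHom_single s f

instance instStarModule : StarModule ℂ (ConvAlg X Γ) where
  star_smul c a := by
    induction a using induction_single with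
    | add a b ha hb => rw [smul_add, star_add, star_add, ha, hb, smul_add]
    | single s f =>
      rw [smul_single, star_single, star_single, smul_single, star_smul, smul_comm]

/-- The inclusion `C(X) → C_c(X ⋊ Γ)`. -/
def ofFun : C(X, ℂ) →⋆ₐ[ℂ] ConvAlg X Γ where
  toFun f := single 1 f
  map_one' := rfl
  map_mul' f g := by rw [single_mul_single, one_smul, one_mul]
  map_zero' := map_zero _
  map_add' f g := map_add _ f g
  commutes' c := rfl
  map_star' f := by rw [star_single, inv_one, one_smul]

/-- The inclusion `Γ → C_c(X ⋊ Γ)`, whose values are unitaries. -/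
def ofGroup : Γ →* unitary (ConvAlg X Γ) where
  toFun s := ⟨single s 1, by
    rw [Unitary.mem_iff, star_single, star_one, action_one, single_mul_single, single_mul_single,
      action_one, action_one, one_mul, inv_mul_cancel, mul_inv_cancel]
    exact ⟨rfl, rfl⟩⟩
  map_one' := rfl
  map_mul' s t := by
    apply Subtype.ext
    change single (s * t) 1 = single s 1 * single t 1
    rw [single_mul_single, action_one, one_mul]

theorem single_eq (s : Γ) (f : C(X, ℂ)) :
    (single s f : ConvAlg X Γ) = ofFun f * ((ofGroup s : unitary (ConvAlg X Γ)) : ConvAlg X Γ) := by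
  change _ = single 1 f * single s 1
  rw [single_mul_single, one_smul, one_mul, mul_one]

end ConvAlg

end Algebra

/-! ### `*`-representations and the associated completions -/

section Completion

variable (X : Type u) (Γ : Type v) [TopologicalSpace X] [CompactSpace X] [Group Γ]
  [MulAction Γ X] [ContinuousConstSMul Γ X]

/-- A (unital) `*`-representation of `C_c(X ⋊ Γ)` on a complex Hilbert space. -/
structure StarRep where
  /-- The Hilbert space. -/
  H : Type (max u v)
  [normedAddCommGroup : NormedAddCommGroup H]
  [innerProductSpace : InnerProductSpace ℂ H]
  [completeSpace : CompleteSpace H]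
  /-- The `*`-homomorphism. -/
  π : ConvAlg X Γ →⋆ₐ[ℂ] (H →L[ℂ] H)

attribute [instance] StarRep.normedAddCommGroup StarRep.innerProductSpace StarRep.completeSpace

variable {X Γ}

/-- The restriction of a `*`-representation of `C_c(X ⋊ Γ)` to a unitary representation of `Γ`. -/
def StarRep.restrict (ρ : StarRep X Γ) : Γ →* unitary (ρ.H →L[ℂ] ρ.H) where
  toFun s := ⟨ρ.π (ConvAlg.ofGroup s : unitary (ConvAlg X Γ)),
    Unitary.map_mem ρ.π (ConvAlg.ofGroup s : unitary (ConvAlg X Γ)).2⟩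
  map_one' := Subtype.ext <| by simp
  map_mul' s t := Subtype.ext <| by simp

theorem norm_le_one_of_mem_unitary {H : Type*} [NormedAddCommGroup H] [InnerProductSpace ℂ H]
    [CompleteSpace H] {U : H →L[ℂ] H} (hU : U ∈ unitary (H →L[ℂ] H)) : ‖U‖ ≤ 1 := by
  have h : ‖U‖ * ‖U‖ ≤ 1 := by
    rw [← CStarRing.norm_star_mul_self, Unitary.star_mul_self_of_mem hU]
    exact ContinuousLinearMap.norm_id_le
  nlinarith [norm_nonneg U]

theorem StarRep.exists_bound (a : ConvAlg X Γ) : ∃ C : ℝ, ∀ ρ : StarRep X Γ, ‖ρ.π a‖ ≤ C := by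
  induction a using ConvAlg.induction_single with
  | add a b ha hb =>
    obtain ⟨C, hC⟩ := ha
    obtain ⟨C', hC'⟩ := hb
    refine ⟨C + C', fun ρ => ?_⟩
    rw [map_add]
    exact (norm_add_le _ _).trans (add_le_add (hC ρ) (hC' ρ))
  | single s f =>
    refine ⟨‖f‖, fun ρ => ?_⟩
    have h1 : ‖ρ.π (ConvAlg.ofFun f)‖ ≤ ‖f‖ :=
      NonUnitalStarAlgHom.norm_apply_le (ρ.π.comp ConvAlg.ofFun) f
    have h2 : ‖ρ.π ((ConvAlg.ofGroup s : unitary (ConvAlg X Γ)) : ConvAlg X Γ)‖ ≤ 1 :=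
      norm_le_one_of_mem_unitary (ρ.restrict s).2
    rw [ConvAlg.single_eq, map_mul]
    calc _ ≤ _ := norm_mul_le _ _
      _ ≤ ‖f‖ * 1 := mul_le_mul h1 h2 (norm_nonneg _) (norm_nonneg _)
      _ = ‖f‖ := mul_one _

/-- The seminorm `a ↦ sup {‖π a‖ : π ∈ S}` on `C_c(X ⋊ Γ)` given by a family `S` of
`*`-representations. -/
def repNorm (S : Set (StarRep X Γ)) (a : ConvAlg X Γ) : ℝ := ⨆ ρ : S, ‖ρ.1.π a‖

section repNorm

variable (S : Set (StarRep X Γ))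

theorem bddAbove_repNorm (a : ConvAlg X Γ) :
    BddAbove (Set.range fun ρ : S => ‖ρ.1.π a‖) := by
  obtain ⟨C, hC⟩ := StarRep.exists_bound a
  exact ⟨C, by rintro _ ⟨ρ, rfl⟩; exact hC ρ.1⟩

theorem le_repNorm (a : ConvAlg X Γ) (ρ : S) : ‖ρ.1.π a‖ ≤ repNorm S a :=
  le_ciSup (bddAbove_repNorm S a) ρ

theorem repNorm_nonneg (a : ConvAlg X Γ) : 0 ≤ repNorm S a :=
  Real.iSup_nonneg fun _ => norm_nonneg _

theorem repNorm_le {a : ConvAlg X Γ} {r : ℝ} (hr : 0 ≤ r) (h : ∀ ρ : S, ‖ρ.1.π a‖ ≤ r) :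
    repNorm S a ≤ r := Real.iSup_le h hr

theorem repNorm_add_le (a b : ConvAlg X Γ) : repNorm S (a + b) ≤ repNorm S a + repNorm S b := by
  refine repNorm_le S (add_nonneg (repNorm_nonneg S a) (repNorm_nonneg S b)) fun ρ => ?_
  rw [map_add]
  exact (norm_add_le _ _).trans (add_le_add (le_repNorm S a ρ) (le_repNorm S b ρ))

theorem repNorm_mul_le (a b : ConvAlg X Γ) : repNorm S (a * b) ≤ repNorm S a * repNorm S b := by
  refine repNorm_le S (mul_nonneg (repNorm_nonneg S a) (repNorm_nonneg S b)) fun ρ => ?_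
  rw [map_mul]
  exact (norm_mul_le _ _).trans
    (mul_le_mul (le_repNorm S a ρ) (le_repNorm S b ρ) (norm_nonneg _) (repNorm_nonneg S a))

theorem repNorm_smul_le (c : ℂ) (a : ConvAlg X Γ) : repNorm S (c • a) ≤ ‖c‖ * repNorm S a := by
  refine repNorm_le S (mul_nonneg (norm_nonneg c) (repNorm_nonneg S a)) fun ρ => ?_
  rw [map_smul, norm_smul]
  exact mul_le_mul_of_nonneg_left (le_repNorm S a ρ) (norm_nonneg c)

theorem repNorm_zero : repNorm S (0 : ConvAlg X Γ) = 0 := by simp [repNorm]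

theorem repNorm_neg (a : ConvAlg X Γ) : repNorm S (-a) = repNorm S a := by simp [repNorm]

theorem repNorm_star (a : ConvAlg X Γ) : repNorm S (star a) = repNorm S a := by
  simp [repNorm, map_star]

theorem repNorm_mul_self_le (a : ConvAlg X Γ) :
    repNorm S a * repNorm S a ≤ repNorm S (star a * a) := by
  have h : repNorm S a ≤ √(repNorm S (star a * a)) := by
    refine repNorm_le S (Real.sqrt_nonneg _) fun ρ => Real.le_sqrt_of_sq_le ?_
    refine le_trans (le_of_eq ?_) (le_repNorm S (star a * a) ρ)
    rw [map_mul, map_star, CStarRing.norm_star_mul_self, sq]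
  calc _ ≤ √(repNorm S (star a * a)) * √(repNorm S (star a * a)) :=
        mul_le_mul h h (repNorm_nonneg S a) (Real.sqrt_nonneg _)
    _ = _ := Real.mul_self_sqrt (repNorm_nonneg S _)

end repNorm

variable (S : Set (StarRep X Γ))

/-- `C_c(X ⋊ Γ)` regarded as a seminormed algebra with the seminorm `repNorm S`. -/
def PreCStar (_S : Set (StarRep X Γ)) : Type (max u v) := ConvAlg X Γ

namespace PreCStar

instance instRing : Ring (PreCStar S) := inferInstanceAs (Ring (ConvAlg X Γ))
instance instAlgebra : Algebra ℂ (PreCStar S) := inferInstanceAs (Algebra ℂ (ConvAlg X Γ))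
instance instStarRing : StarRing (PreCStar S) := inferInstanceAs (StarRing (ConvAlg X Γ))
instance instStarModule : StarModule ℂ (PreCStar S) := inferInstanceAs (StarModule ℂ (ConvAlg X Γ))

instance instSeminormedRing : SeminormedRing (PreCStar S) where
  __ := instRing S
  __ := AddGroupSeminorm.toSeminormedAddCommGroup (E := PreCStar S)
    { toFun := repNorm S
      map_zero' := repNorm_zero S
      add_le' := repNorm_add_le S
      neg' := repNorm_neg S }
  norm_mul_le := repNorm_mul_le S

theorem norm_def (a : PreCStar S) : ‖a‖ = repNorm S a := rfl

instance instNormedAlgebra : NormedAlgebra ℂ (PreCStar S) where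
  __ := instAlgebra S
  norm_smul_le := repNorm_smul_le S

instance instNormedStarGroup : NormedStarGroup (PreCStar S) where
  norm_star_le a := (repNorm_star S a).le

end PreCStar

/-- The `C^*`-algebra obtained from `C_c(X ⋊ Γ)` by (Hausdorff) completion with respect to
`a ↦ sup {‖π a‖ : π ∈ S}`. -/
def CStarCompletion : Type (max u v) := UniformSpace.Completion (PreCStar S)

namespace CStarCompletion

open UniformSpace

instance instNormedRing : NormedRing (CStarCompletion S) :=
  inferInstanceAs (NormedRing (Completion (PreCStar S)))

instance instCompleteSpace : CompleteSpace (CStarCompletion S) :=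
  inferInstanceAs (CompleteSpace (Completion (PreCStar S)))

instance instAlgebra : Algebra ℂ (CStarCompletion S) :=
  inferInstanceAs (Algebra ℂ (Completion (PreCStar S)))

/-- The canonical map on the level of sets. -/
def mk (a : PreCStar S) : CStarCompletion S := (a : Completion (PreCStar S))

theorem continuous_mk : Continuous (mk S) := Completion.continuous_coe _

theorem denseRange_mk : DenseRange (mk S) := Completion.denseRange_coe

theorem norm_mk (a : PreCStar S) : ‖mk S a‖ = ‖a‖ := Completion.norm_coe a

theorem mk_add (a b : PreCStar S) : mk S (a + b) = mk S a + mk S b := Completion.coe_add a b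

theorem mk_mul (a b : PreCStar S) : mk S (a * b) = mk S a * mk S b := Completion.coe_mul a b

theorem mk_smul (c : ℂ) (a : PreCStar S) : mk S (c • a) = c • mk S a := Completion.coe_smul c a

@[elab_as_elim]
theorem induction {p : CStarCompletion S → Prop} (x : CStarCompletion S)
    (hp : IsClosed {x | p x}) (h : ∀ a, p (mk S a)) : p x :=
  Completion.induction_on x hp h

instance instNormedAlgebra : NormedAlgebra ℂ (CStarCompletion S) where
  __ := instAlgebra S
  norm_smul_le c x := by
    induction x using induction with
    | hp =>
      simp only [Algebra.smul_def]
      exact isClosed_le (by fun_prop) (by fun_prop)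
    | h a =>
      rw [← mk_smul, norm_mk, norm_mk]
      exact norm_smul_le c a

/-- The involution, extended by continuity. -/
instance instStar : Star (CStarCompletion S) :=
  ⟨Completion.map (star : PreCStar S → PreCStar S)⟩

theorem uniformContinuous_star : UniformContinuous (star : PreCStar S → PreCStar S) :=
  (starNormedAddGroupHom (E := PreCStar S)).uniformContinuous

theorem star_mk (a : PreCStar S) : star (mk S a) = mk S (star a) :=
  Completion.map_coe (uniformContinuous_star S) a

theorem continuous_star : Continuous (star : CStarCompletion S → CStarCompletion S) :=
  Completion.continuous_map

instance instStarRing : StarRing (CStarCompletion S) where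
  star_involutive x := by
    have h := continuous_star S
    induction x using induction with
    | hp => exact isClosed_eq (by fun_prop) (by fun_prop)
    | h a => rw [star_mk, star_mk, star_star]
  star_mul x y := by
    have h := continuous_star S
    induction x using induction with
    | hp => exact isClosed_eq (by fun_prop) (by fun_prop)
    | h a =>
      induction y using induction with
      | hp => exact isClosed_eq (by fun_prop) (by fun_prop)
      | h b => rw [← mk_mul, star_mk, star_mk, star_mk, star_mul, mk_mul]
  star_add x y := by
    have h := continuous_star S
    induction x using induction with
    | hp => exact isClosed_eq (by fun_prop) (by fun_prop)
    | h a =>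
      induction y using induction with
      | hp => exact isClosed_eq (by fun_prop) (by fun_prop)
      | h b => rw [← mk_add, star_mk, star_mk, star_mk, star_add, mk_add]

instance instStarModule : StarModule ℂ (CStarCompletion S) where
  star_smul c x := by
    have h := continuous_star S
    induction x using induction with
    | hp =>
      simp only [Algebra.smul_def]
      exact isClosed_eq (by fun_prop) (by fun_prop)
    | h a => rw [← mk_smul, star_mk, star_mk, star_smul, mk_smul]

instance instCStarRing : CStarRing (CStarCompletion S) where
  norm_mul_self_le x := by
    have h := continuous_star S
    induction x using induction with
    | hp => exact isClosed_le (by fun_prop) (by fun_prop)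
    | h a =>
      rw [star_mk, ← mk_mul, norm_mk, norm_mk]
      exact repNorm_mul_self_le S a

instance instCStarAlgebra : CStarAlgebra (CStarCompletion S) where

/-- The canonical `*`-homomorphism from `C_c(X ⋊ Γ)` to the completion. -/
def of : ConvAlg X Γ →⋆ₐ[ℂ] CStarCompletion S where
  toFun := mk S
  map_one' := rfl
  map_mul' := mk_mul S
  map_zero' := rfl
  map_add' := mk_add S
  commutes' _ := rfl
  map_star' a := (star_mk S a).symm

theorem norm_of (a : ConvAlg X Γ) : ‖of S a‖ = repNorm S a := norm_mk S a

theorem denseRange_of : DenseRange (of S) := denseRange_mk S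

end CStarCompletion

end Completion

/-! ### Ideals of `ℓ^∞(Γ)`, `D`-representations, ideal completions -/

section Ideals

/-- The algebra `ℓ^∞(Γ)` of bounded complex functions on `Γ`. -/
abbrev BddFun (Γ : Type v) : Type v := lp (fun _ : Γ => ℂ) ∞

variable {X : Type u} {Γ : Type v}

/-- The function `φ : Γ → ℂ` is (bounded and) an element of the ideal `D` of `ℓ^∞(Γ)`. -/
def BelongsTo (D : Ideal (BddFun Γ)) (φ : Γ → ℂ) : Prop := ∃ d ∈ D, ∀ s, d s = φ s

variable [Group Γ]

/-- Invariance of an ideal of `ℓ^∞(Γ)` under left and right translations. -/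
def TranslationInvariant (D : Ideal (BddFun Γ)) : Prop :=
  ∀ d ∈ D, ∀ g : Γ, BelongsTo D (fun s => d (g * s)) ∧ BelongsTo D (fun s => d (s * g))

/-- A unitary representation `u` of `Γ` is a `D`-representation if there is a dense subspace
`H₀` such that the matrix coefficients `s ↦ ⟨u_s ξ, η⟩` lie in `D` for all `ξ, η ∈ H₀`.
(Mathlib's inner product is linear in the second variable.) -/
def IsDRep (D : Ideal (BddFun Γ)) {H : Type w} [NormedAddCommGroup H] [InnerProductSpace ℂ H]
    [CompleteSpace H] (u : Γ →* unitary (H →L[ℂ] H)) : Prop :=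
  ∃ H₀ : Submodule ℂ H, Dense (H₀ : Set H) ∧
    ∀ ξ ∈ H₀, ∀ η ∈ H₀, BelongsTo D (fun s => inner ℂ η ((u s : H →L[ℂ] H) ξ))

variable [TopologicalSpace X] [CompactSpace X] [MulAction Γ X] [ContinuousConstSMul Γ X]

/-- The `*`-representations of `C_c(X ⋊ Γ)` whose restriction to `Γ` is a `D`-representation. -/
def dReps (X : Type u) [TopologicalSpace X] [CompactSpace X] [MulAction Γ X]
    [ContinuousConstSMul Γ X] (D : Ideal (BddFun Γ)) : Set (StarRep X Γ) :=
  {ρ | IsDRep D ρ.restrict}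

/-- The full crossed product `C^*(X ⋊ Γ)`: the completion of `C_c(X ⋊ Γ)` with respect to the
supremum over all `*`-representations. -/
abbrev FullCrossedProduct (X : Type u) (Γ : Type v) [Group Γ] [TopologicalSpace X]
    [CompactSpace X] [MulAction Γ X] [ContinuousConstSMul Γ X] : Type (max u v) :=
  CStarCompletion (Set.univ : Set (StarRep X Γ))

/-- The ideal completion `C^*_D(X ⋊ Γ)`: the completion of `C_c(X ⋊ Γ)` with respect to the
supremum over all `D`-representations. -/
abbrev IdealCrossedProduct (X : Type u) [TopologicalSpace X] [CompactSpace X] [MulAction Γ X]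
    [ContinuousConstSMul Γ X] (D : Ideal (BddFun Γ)) : Type (max u v) :=
  CStarCompletion (dReps X D)

/-- The canonical map `C_c(X ⋊ Γ) → C^*(X ⋊ Γ)`. -/
abbrev toFull (X : Type u) (Γ : Type v) [Group Γ] [TopologicalSpace X]
    [CompactSpace X] [MulAction Γ X] [ContinuousConstSMul Γ X] :
    ConvAlg X Γ →⋆ₐ[ℂ] FullCrossedProduct X Γ := CStarCompletion.of Set.univ

/-- The canonical map `C_c(X ⋊ Γ) → C^*_D(X ⋊ Γ)`. -/
abbrev toIdeal (X : Type u) [TopologicalSpace X] [CompactSpace X] [MulAction Γ X]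
    [ContinuousConstSMul Γ X] (D : Ideal (BddFun Γ)) :
    ConvAlg X Γ →⋆ₐ[ℂ] IdealCrossedProduct X D := CStarCompletion.of (dReps X D)

end Ideals

/-! ### Positive definite functions on `X × Γ` -/

section PositiveDefinite

variable {X : Type u} {Γ : Type v} [TopologicalSpace X] [Group Γ] [MulAction Γ X]

/-- `h : X × Γ → ℂ` is positive definite if for all `s₁, …, sₙ ∈ Γ` and `x ∈ X` the matrix
`[h(sᵢ x, sᵢ sⱼ⁻¹)]` is positive semidefinite. -/
def PositiveDefinite (h : X × Γ → ℂ) : Prop :=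
  ∀ (n : ℕ) (s : Fin n → Γ) (x : X),
    (Matrix.of fun i j => h (s i • x, s i * (s j)⁻¹)).PosSemidef

/-- The function `h(s) ∈ C(X)`, `h(s)(x) = h(x, s)`. -/
def slice [TopologicalSpace Γ] (h : C(X × Γ, ℂ)) (s : Γ) : C(X, ℂ) where
  toFun x := h (x, s)
  continuous_toFun := by fun_prop

end PositiveDefinite

end CrossedProduct

end

open CrossedProduct

noncomputable section

namespace CrossedProduct

universe u v

/-! ### Continuous square roots of matrix valued functions -/

section MatrixSqrt

/-! Only `‖π(a)ξ‖ ≤ ‖a‖_D ‖ξ‖` has to be shown, for an arbitrary representation `π`, vector `ξ` and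
`a`; the reverse comparison of seminorms is a supremum over a smaller family. Let `φ(a) = ⟨ξ,
π(a)ξ⟩` and let `m_n` multiply the coefficient at `s` by `h_n(·, s)`.

The functional `φ ∘ m_n` is again positive: by positive definiteness of `h_n`, `m_n(b b^*)` is a
finite sum of elements `c c^*` (`exists_multiplier_mul_star`), which rests on a continuous
factorization `N^* N` of matrix-valued functions. Its GNS representation is a `D`-representation,
because coefficients at vectors coming from the algebra are dominated by translates of `s ↦ ‖h_n(·,
s)‖` (`belongsTo_coefficient`). Testing it on the cyclic vector gives `φ(m_n(a^* a)) ≤ ‖a‖_D²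
φ(m_n(1))`.

As `n → ∞` this becomes `‖π(a)ξ‖² ≤ ‖a‖_D² ‖ξ‖²`. So the two seminorms agree
(`repNorm_univ_eq_repNorm_dReps`), and hence so do the completions. -/

open scoped Matrix.Norms.L2Operator MatrixOrder in
theorem exists_continuous_matrix_sqrt {X n : Type*} [TopologicalSpace X] [CompactSpace X]
    [Fintype n] [DecidableEq n] (M : X → Matrix n n ℂ) (hM : Continuous M)
    (hpos : ∀ x, (M x).PosSemidef) :
    ∃ N : X → Matrix n n ℂ, Continuous N ∧ ∀ x, M x = (N x).conjTranspose * N x := by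
  obtain ⟨R, hR⟩ := (isCompact_range hM).isBounded.exists_norm_le
  -- One compact interval containing all the spectra is what makes the functional calculus
  -- continuous in `x`. The factor `‖1‖` covers empty `n`, where the norm of the identity is `0`.
  have hspec : ∀ x, spectrum ℝ (M x) ⊆ Set.Icc (-(R * ‖(1 : Matrix n n ℂ)‖))
      (R * ‖(1 : Matrix n n ℂ)‖) := fun x t ht => by
    have h := (spectrum.norm_le_norm_mul_of_mem ht).trans
      (mul_le_mul_of_nonneg_right (hR _ ⟨x, rfl⟩) (norm_nonneg (1 : Matrix n n ℂ)))
    exact abs_le.1 (by simpa using h)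
  refine ⟨fun x => cfc Real.sqrt (M x), Continuous.cfc' isCompact_Icc Real.sqrt hM hspec
    Real.continuous_sqrt.continuousOn fun x => (hpos x).1, fun x => ?_⟩
  have hsa : IsSelfAdjoint (cfc Real.sqrt (M x)) := cfc_predicate _ _
  have h0 : 0 ≤ M x := Matrix.nonneg_iff_posSemidef.2 (hpos x)
  rw [← Matrix.star_eq_conjTranspose, hsa.star_eq,
    ← cfc_mul Real.sqrt Real.sqrt (M x) Real.continuous_sqrt.continuousOn
      Real.continuous_sqrt.continuousOn]
  conv_lhs => rw [← cfc_id' ℝ (M x) (hpos x).1]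
  refine cfc_congr fun t ht => ?_
  exact (Real.mul_self_sqrt (spectrum_nonneg_of_nonneg h0 ht)).symm

end MatrixSqrt

/-! ### The GNS construction -/

section GNS

open UniformSpace

variable {A : Type u} [Ring A] [StarRing A] [Algebra ℂ A] [StarModule ℂ A]

/-- A linear functional on a `*`-algebra is positive if `0 ≤ φ (a^* a)` for all `a`. -/
def PositiveFunctional (φ : A →ₗ[ℂ] ℂ) : Prop := ∀ a, 0 ≤ φ (star a * a)

/-- Polarization: since `φ(b^* b)` is real for `b = 1, a, 1 + a, 1 + ia`, both `φ(a) + φ(a^*)` and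
`i(φ(a) - φ(a^*))` are real. -/
theorem PositiveFunctional.map_star {φ : A →ₗ[ℂ] ℂ} (hφ : PositiveFunctional φ) (a : A) :
    φ (star a) = star (φ a) := by
  have h0 := Complex.le_def.1 (hφ 1)
  have h1 := Complex.le_def.1 (hφ a)
  have h2 := Complex.le_def.1 (hφ (1 + a))
  have h3 := Complex.le_def.1 (hφ (1 + Complex.I • a))
  simp [add_mul, mul_add, smul_smul] at h0 h1 h2 h3
  refine Complex.ext ?_ ?_ <;> simp <;> linarith

/-- The bound needed in order that left multiplication by `a` is bounded on the GNS space. -/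
def BoundedMul (φ : A →ₗ[ℂ] ℂ) (a : A) : Prop :=
  ∃ C : ℝ, 0 ≤ C ∧ ∀ b, (φ (star (a * b) * (a * b))).re ≤ C ^ 2 * (φ (star b * b)).re

/-- A copy of `A` which carries the semi-inner product given by a positive functional `φ`. -/
def PreGNS {φ : A →ₗ[ℂ] ℂ} (_ : PositiveFunctional φ) : Type u := A

variable {φ : A →ₗ[ℂ] ℂ} (hφ : PositiveFunctional φ)

namespace PreGNS

instance instAddCommGroup : AddCommGroup (PreGNS hφ) := inferInstanceAs (AddCommGroup A)
instance instModule : Module ℂ (PreGNS hφ) := inferInstanceAs (Module ℂ A)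

/-- The identity map. -/
def equiv : A ≃ₗ[ℂ] PreGNS hφ := LinearEquiv.refl ℂ A

/-- The semi-inner product `⟨a, b⟩ = φ (a^* b)`. -/
abbrev core : PreInnerProductSpace.Core ℂ (PreGNS hφ) where
  inner a b := φ (star ((equiv hφ).symm a) * (equiv hφ).symm b)
  conj_inner_symm a b := by
    rw [← Complex.star_def, ← hφ.map_star, star_mul, star_star]
  re_inner_nonneg a := (Complex.le_def.1 (hφ ((equiv hφ).symm a))).1
  add_left a b c := by rw [map_add, star_add, add_mul, map_add]
  smul_left a b c := by simp

instance instSeminormedAddCommGroup : SeminormedAddCommGroup (PreGNS hφ) :=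
  InnerProductSpace.Core.toSeminormedAddCommGroup (c := core hφ)

instance instInnerProductSpace : InnerProductSpace ℂ (PreGNS hφ) :=
  InnerProductSpace.ofCore (core hφ)

theorem inner_equiv (a b : A) : inner ℂ (equiv hφ a) (equiv hφ b) = φ (star a * b) := rfl

theorem norm_equiv_sq (a : A) : ‖equiv hφ a‖ ^ 2 = (φ (star a * a)).re := by
  rw [norm_sq_eq_re_inner (𝕜 := ℂ), inner_equiv]
  rfl

variable {hφ} (hb : ∀ a, BoundedMul φ a)

/-- Left multiplication on the semi-inner product space. -/
def leftMul (a : A) : PreGNS hφ →L[ℂ] PreGNS hφ :=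
  ((equiv hφ).toLinearMap ∘ₗ LinearMap.mulLeft ℂ a ∘ₗ (equiv hφ).symm.toLinearMap).mkContinuous
    (hb a).choose fun x => by
      obtain ⟨x, rfl⟩ := (equiv hφ).surjective x
      have h := (hb a).choose_spec
      refine le_of_sq_le_sq ?_ (mul_nonneg h.1 (norm_nonneg _))
      rw [mul_pow, norm_equiv_sq]
      simpa [norm_equiv_sq] using h.2 x

theorem leftMul_equiv (a b : A) : leftMul hb a (equiv hφ b) = equiv hφ (a * b) := rfl

end PreGNS

/-- The GNS representation associated with a positive functional. -/
def gnsRep {φ : A →ₗ[ℂ] ℂ} (hφ : PositiveFunctional φ) (hb : ∀ a, BoundedMul φ a) :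
    A →⋆ₐ[ℂ] (Completion (PreGNS hφ) →L[ℂ] Completion (PreGNS hφ)) :=
  -- Bounded operators that agree on the dense image of `A` are equal, so the algebraic laws reduce
  -- to identities in `A`.
  have key : ∀ {S T : Completion (PreGNS hφ) →L[ℂ] Completion (PreGNS hφ)},
      (∀ b : A, S (PreGNS.equiv hφ b : Completion (PreGNS hφ)) =
        T (PreGNS.equiv hφ b : Completion (PreGNS hφ))) → S = T := fun {S T} h => by
    ext x
    induction x using Completion.induction_on with
    | hp => exact isClosed_eq S.continuous T.continuous
    | ih x => exact h x
  { toFun a := (PreGNS.leftMul hb a).completion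
    map_one' := key fun b => by simp [PreGNS.leftMul_equiv]
    map_mul' a a' := key fun b => by simp [PreGNS.leftMul_equiv, mul_assoc]
    map_zero' := key fun b => by
      simp only [ContinuousLinearMap.completion_apply_coe, PreGNS.leftMul_equiv, zero_mul, map_zero]
      exact Completion.coe_zero
    map_add' a a' := key fun b => by
      simp [PreGNS.leftMul_equiv, add_mul, Completion.coe_add]
    commutes' c := key fun b => by
      simp [PreGNS.leftMul_equiv, Algebra.algebraMap_eq_smul_one]
    map_star' a := by
      refine (ContinuousLinearMap.eq_adjoint_iff _ _).2 fun x y => ?_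
      induction x, y using Completion.induction_on₂ with
      | hp => apply isClosed_eq <;> fun_prop
      | ih x y =>
        obtain ⟨x, rfl⟩ := (PreGNS.equiv hφ).surjective x
        obtain ⟨y, rfl⟩ := (PreGNS.equiv hφ).surjective y
        simp [PreGNS.leftMul_equiv, PreGNS.inner_equiv, mul_assoc] }

theorem gnsRep_apply (hb : ∀ a, BoundedMul φ a) (a b : A) :
    gnsRep hφ hb a (PreGNS.equiv hφ b : Completion (PreGNS hφ)) =
      (PreGNS.equiv hφ (a * b) : Completion (PreGNS hφ)) := by
  change (PreGNS.leftMul hb a).completion _ = _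
  simp [PreGNS.leftMul_equiv]

end GNS

/-! ### Ideals of `ℓ^∞(Γ)` -/

section BelongsTo

variable {Γ : Type v} {D : Ideal (BddFun Γ)} {φ ψ : Γ → ℂ}

theorem BelongsTo.add (hφ : BelongsTo D φ) (hψ : BelongsTo D ψ) :
    BelongsTo D (fun s => φ s + ψ s) := by
  obtain ⟨d, hd, hdφ⟩ := hφ
  obtain ⟨e, he, heψ⟩ := hψ
  exact ⟨d + e, D.add_mem hd he, fun s => congrArg₂ (· + ·) (hdφ s) (heψ s)⟩

/-- Ideals of `ℓ^∞(Γ)` are solid: `φ = (φ/ψ) ψ` with `φ/ψ` bounded, and `φ` vanishes wherever `ψ`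
does. -/
theorem BelongsTo.of_norm_le (hψ : BelongsTo D ψ) {C : ℝ} (h : ∀ s, ‖φ s‖ ≤ C * ‖ψ s‖) :
    BelongsTo D φ := by
  obtain ⟨d, hd, hdψ⟩ := hψ
  have hmem : Memℓp (E := fun _ : Γ => ℂ) (fun s => φ s / ψ s) ∞ := by
    -- At zeros of `ψ` the quotient is `0` by convention, and `C` is not assumed nonnegative.
    refine memℓp_infty ⟨max C 0, ?_⟩
    rintro _ ⟨s, rfl⟩
    change ‖φ s / ψ s‖ ≤ _
    rw [norm_div]
    rcases eq_or_ne (ψ s) 0 with h0 | h0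
    · simp [h0]
    · exact (div_le_iff₀ (norm_pos_iff.2 h0)).2 ((h s).trans
        (mul_le_mul_of_nonneg_right (le_max_left _ _) (norm_nonneg _)))
  refine ⟨(⟨_, hmem⟩ : BddFun Γ) * d, D.mul_mem_left _ hd, fun s => ?_⟩
  rw [lp.infty_coeFn_mul, Pi.mul_apply, hdψ]
  change φ s / ψ s * ψ s = φ s
  rcases eq_or_ne (ψ s) 0 with h0 | h0
  · have := h s
    rw [h0, norm_zero, mul_zero] at this
    rw [h0, mul_zero, norm_le_zero_iff.1 this]
  · exact div_mul_cancel₀ _ h0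

theorem BelongsTo.translate [Group Γ] (hD : TranslationInvariant D) (hφ : BelongsTo D φ)
    (g g' : Γ) : BelongsTo D (fun s => φ (g * s * g')) := by
  obtain ⟨d, hd, hdφ⟩ := hφ
  obtain ⟨e, he, hed⟩ := (hD d hd g').2
  obtain ⟨e', he', hee⟩ := (hD e he g).1
  exact ⟨e', he', fun s => (hee s).trans ((hed (g * s)).trans (hdφ (g * s * g')))⟩

end BelongsTo

/-! ### Bounded left multiplication -/

section BoundedMul

variable {A : Type u} [Ring A] [StarRing A] [Algebra ℂ A] {φ : A →ₗ[ℂ] ℂ}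

theorem BoundedMul.mul {a b : A} (ha : BoundedMul φ a) (hb : BoundedMul φ b) :
    BoundedMul φ (a * b) := by
  obtain ⟨C, hC, h⟩ := ha
  obtain ⟨C', hC', h'⟩ := hb
  refine ⟨C * C', mul_nonneg hC hC', fun c => ?_⟩
  rw [mul_assoc]
  refine (h _).trans ?_
  rw [mul_pow, mul_assoc]
  exact mul_le_mul_of_nonneg_left (h' c) (sq_nonneg C)

theorem BoundedMul.add [StarModule ℂ A] (hφ : PositiveFunctional φ) {a b : A} (ha : BoundedMul φ a)
    (hb : BoundedMul φ b) : BoundedMul φ (a + b) := by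
  obtain ⟨C, hC, h⟩ := ha
  obtain ⟨C', hC', h'⟩ := hb
  refine ⟨C + C', add_nonneg hC hC', fun c => ?_⟩
  have h1 := h c
  have h2 := h' c
  rw [← PreGNS.norm_equiv_sq hφ, ← PreGNS.norm_equiv_sq hφ, ← mul_pow] at h1 h2 ⊢
  have h1 := le_of_sq_le_sq h1 (mul_nonneg hC (norm_nonneg _))
  have h2 := le_of_sq_le_sq h2 (mul_nonneg hC' (norm_nonneg _))
  refine pow_le_pow_left₀ (norm_nonneg _) ?_ 2
  rw [add_mul, map_add, add_mul]
  exact (norm_add_le _ _).trans (add_le_add h1 h2)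

theorem BoundedMul.of_star_mul_self {a : A} (ha : star a * a = 1) : BoundedMul φ a :=
  ⟨1, zero_le_one, fun b => by
    rw [star_mul, mul_assoc, ← mul_assoc (star a), ha, one_mul, one_pow, one_mul]⟩

/-- An algebraic form of `a^* a ≤ C²`: compressing the identity by `c` and applying `φ`, the term
`φ((bc)^*(bc)) ≥ 0` can be dropped. -/
theorem BoundedMul.of_star_mul_self_add (hφ : PositiveFunctional φ) {a b : A} {C : ℝ}
    (hC : 0 ≤ C) (hab : star a * a + star b * b = ((C ^ 2 : ℝ) : ℂ) • 1) : BoundedMul φ a :=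
  ⟨C, hC, fun c => by
    have h : star (a * c) * (a * c) + star (b * c) * (b * c) =
        ((C ^ 2 : ℝ) : ℂ) • (star c * c) := by
      calc _ = star c * ((star a * a + star b * b) * c) := by
            simp only [star_mul, add_mul, mul_add, mul_assoc]
        _ = _ := by rw [hab, smul_one_mul, mul_smul_comm]
    have h' := congrArg (fun x => (φ x).re) h
    simp only [map_add, Complex.add_re, map_smul, smul_eq_mul, Complex.re_ofReal_mul] at h'
    have := (Complex.le_def.1 (hφ (b * c))).1
    rw [Complex.zero_re] at this
    linarith⟩

end BoundedMul

/-! ### Multipliers of the convolution algebra -/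

section Multiplier

variable {X : Type u} {Γ : Type v} [TopologicalSpace X] [Group Γ] [MulAction Γ X]
  [ContinuousConstSMul Γ X]

namespace ConvAlg

theorem coeff_smul (c : ℂ) (a : ConvAlg X Γ) : (c • a).coeff = c • a.coeff :=
  SkewMonoidAlgebra.coeff_smul c a

/-- Positivity alone suffices: the algebra is spanned by products of a function and a group unitary,
and each factor acts boundedly. -/
theorem boundedMul [CompactSpace X] {φ : ConvAlg X Γ →ₗ[ℂ] ℂ} (hφ : PositiveFunctional φ)
    (a : ConvAlg X Γ) : BoundedMul φ a := by
  induction a using induction_single with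
  | add a b ha hb => exact ha.add hφ hb
  | single s f =>
    rw [single_eq]
    refine BoundedMul.mul ?_
      (BoundedMul.of_star_mul_self (Unitary.star_mul_self_of_mem (ofGroup s).2))
    -- Chosen so that `f^* f + g^* g = ‖f‖²`.
    let g : C(X, ℂ) := ⟨fun x => (√(‖f‖ ^ 2 - ‖f x‖ ^ 2) : ℝ), by fun_prop⟩
    refine BoundedMul.of_star_mul_self_add hφ (b := ofFun g) (norm_nonneg f) ?_
    rw [← map_star, ← map_star, ← map_mul, ← map_mul, ← map_add, ← map_one ofFun, ← map_smul]
    congr 1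
    ext x
    have hx : ‖f x‖ ^ 2 ≤ ‖f‖ ^ 2 := pow_le_pow_left₀ (norm_nonneg _) (f.norm_coe_le_norm x) 2
    have h1 : star (f x) * f x = ((‖f x‖ ^ 2 : ℝ) : ℂ) := by
      rw [Complex.star_def, ← Complex.normSq_eq_conj_mul_self, Complex.normSq_eq_norm_sq]
    have h2 : star (g x) * g x = ((‖f‖ ^ 2 - ‖f x‖ ^ 2 : ℝ) : ℂ) := by
      change star ((√(‖f‖ ^ 2 - ‖f x‖ ^ 2) : ℝ) : ℂ) * ((√(‖f‖ ^ 2 - ‖f x‖ ^ 2) : ℝ) : ℂ) = _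
      rw [Complex.star_def, Complex.conj_ofReal, ← Complex.ofReal_mul,
        Real.mul_self_sqrt (sub_nonneg.2 hx)]
    change star (f x) * f x + star (g x) * g x = ((‖f‖ ^ 2 : ℝ) : ℂ) * 1
    rw [h1, h2, ← Complex.ofReal_add, mul_one, add_sub_cancel]

theorem exists_eq_sum_single (a : ConvAlg X Γ) :
    ∃ (n : ℕ) (s : Fin n → Γ) (f : Fin n → C(X, ℂ)), a = ∑ i, single (s i) (f i) := by
  induction a using induction_single with
  | single s f => exact ⟨1, fun _ => s, fun _ => f, by simp⟩
  | add a b ha hb =>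
    obtain ⟨n, s, f, rfl⟩ := ha
    obtain ⟨m, t, g, rfl⟩ := hb
    exact ⟨n + m, Fin.append s t, Fin.append f g, by simp [Fin.sum_univ_add]⟩

/-- The linear map `∑ f_s s ↦ ∑ f_s k_s s`. -/
def multiplier (k : Γ → C(X, ℂ)) : ConvAlg X Γ →ₗ[ℂ] ConvAlg X Γ where
  toFun a := a.coeff.sum fun s f => single s (f * k s)
  map_add' a b := by
    rw [coeff_add]
    exact Finsupp.sum_add_index' (fun s => by rw [zero_mul, map_zero])
      (fun s f g => by rw [add_mul, map_add])
  map_smul' c a := by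
    rw [coeff_smul, Finsupp.sum_smul_index' (fun s => by rw [zero_mul, map_zero]),
      RingHom.id_apply, Finsupp.smul_sum]
    simp only [smul_single, smul_mul_assoc]

theorem multiplier_single (k : Γ → C(X, ℂ)) (s : Γ) (f : C(X, ℂ)) :
    multiplier k (single s f) = single s (f * k s) := by
  refine Finsupp.sum_single_index (h := fun s f => single s (f * k s)) ?_
  rw [zero_mul, map_zero]

/-- For `b = ∑ f_i s_i`, the `(i, j)` term of `b b^*` sits at `s_i s_j⁻¹`, where the multiplier
inserts an entry of the positive matrix. Writing that matrix as `N^* N` splits the double sum into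
one term `c_l c_l^*` for each row `l` of `N`. Repetitions among the `s_i` are harmless, since
positivity is assumed for all tuples. -/
theorem exists_multiplier_mul_star [CompactSpace X] {k : Γ → C(X, ℂ)}
    (hk : ∀ (n : ℕ) (s : Fin n → Γ) (x : X),
      (Matrix.of fun i j => k (s i * (s j)⁻¹) (s i • x)).PosSemidef) (b : ConvAlg X Γ) :
    ∃ (n : ℕ) (c : Fin n → ConvAlg X Γ), multiplier k (b * star b) = ∑ i, c i * star (c i) := by
  obtain ⟨n, s, f, rfl⟩ := exists_eq_sum_single b
  obtain ⟨N, hN, hkN⟩ := exists_continuous_matrix_sqrt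
    (fun x => Matrix.of fun i j => k (s i * (s j)⁻¹) (s i • x)) (by fun_prop) (hk n s)
  let G : Fin n → Fin n → C(X, ℂ) := fun l i => ⟨fun x => star (N x l i), by fun_prop⟩
  refine ⟨n, fun l => ∑ i, single (s i) (f i * s i • G l i), ?_⟩
  simp only [star_sum, Finset.sum_mul_sum, map_sum, star_single, single_mul_single,
    multiplier_single]
  conv_rhs => rw [Finset.sum_comm]
  refine Finset.sum_congr rfl fun i _ => ?_
  conv_rhs => rw [Finset.sum_comm]
  refine Finset.sum_congr rfl fun j _ => ?_
  rw [← map_sum]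
  congr 1
  ext x
  -- The matrix at `y` has entries evaluated at `s_i y`, so `y = s_i⁻¹ x` gives the value at `x`;
  -- this is also why `G` is translated by `s_i`.
  have h := congrFun (congrFun (hkN ((s i)⁻¹ • x)) i) j
  simp only [Matrix.of_apply, smul_inv_smul, Matrix.mul_apply, Matrix.conjTranspose_apply] at h
  simp only [ContinuousMap.mul_apply, ContinuousMap.sum_apply, action_apply, h,
    ContinuousMap.star_apply, star_mul', inv_inv, inv_smul_smul, Finset.mul_sum, G,
    ContinuousMap.coe_mk, star_star]
  exact Finset.sum_congr rfl fun l _ => by ring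

end ConvAlg

end Multiplier

/-! ### Comparison of the full and the ideal seminorm -/

section Comparison

open UniformSpace

variable {X : Type u} {Γ : Type v} [TopologicalSpace X] [CompactSpace X] [Group Γ]
  [MulAction Γ X] [ContinuousConstSMul Γ X]

/-- The functional `a ↦ ⟨ξ, π(a) ξ⟩`. -/
def StarRep.vectorFunctional (ρ : StarRep X Γ) (ξ : ρ.H) : ConvAlg X Γ →ₗ[ℂ] ℂ where
  toFun a := inner ℂ ξ (ρ.π a ξ)
  map_add' a b := by rw [map_add, add_apply, inner_add_right]
  map_smul' c a := by
    rw [map_smul, smul_apply, inner_smul_right, RingHom.id_apply, smul_eq_mul]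

theorem StarRep.vectorFunctional_star_mul_self (ρ : StarRep X Γ) (ξ : ρ.H) (a : ConvAlg X Γ) :
    ρ.vectorFunctional ξ (star a * a) = ((‖ρ.π a ξ‖ ^ 2 : ℝ) : ℂ) := by
  change inner ℂ ξ (ρ.π (star a * a) ξ) = _
  rw [map_mul, map_star, mul_apply_eq_comp, ContinuousLinearMap.star_eq_adjoint,
    ContinuousLinearMap.adjoint_inner_right, inner_self_eq_norm_sq_to_K]
  norm_cast

theorem StarRep.norm_single_le (ρ : StarRep X Γ) (s : Γ) (f : C(X, ℂ)) :
    ‖ρ.π (ConvAlg.single s f)‖ ≤ ‖f‖ := by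
  rw [ConvAlg.single_eq, map_mul]
  refine (norm_mul_le _ _).trans ?_
  rw [← mul_one ‖f‖]
  exact mul_le_mul (NonUnitalStarAlgHom.norm_apply_le (ρ.π.comp ConvAlg.ofFun) f)
    (norm_le_one_of_mem_unitary (ρ.restrict s).2) (norm_nonneg _) (norm_nonneg _)

/-- This estimate serves twice: for domination of GNS coefficients and for convergence of the
multiplied functionals. -/
theorem StarRep.norm_vectorFunctional_single_le (ρ : StarRep X Γ) (ξ : ρ.H) (s : Γ)
    (f : C(X, ℂ)) : ‖ρ.vectorFunctional ξ (ConvAlg.single s f)‖ ≤ ‖f‖ * ‖ξ‖ ^ 2 :=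
  calc _ ≤ ‖ξ‖ * ‖ρ.π (ConvAlg.single s f) ξ‖ := norm_inner_le_norm _ _
    _ ≤ ‖ξ‖ * (‖f‖ * ‖ξ‖) := mul_le_mul_of_nonneg_left
        (ContinuousLinearMap.le_of_opNorm_le _ (ρ.norm_single_le s f) ξ) (norm_nonneg _)
    _ = _ := by ring

theorem norm_action_le (s : Γ) (f : C(X, ℂ)) : ‖s • f‖ ≤ ‖f‖ :=
  (ContinuousMap.norm_le _ (norm_nonneg f)).2 fun x => f.norm_coe_le_norm (s⁻¹ • x)

theorem positiveFunctional_vectorFunctional_comp_multiplier (ρ : StarRep X Γ) (ξ : ρ.H)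
    {k : Γ → C(X, ℂ)} (hk : ∀ (n : ℕ) (s : Fin n → Γ) (x : X),
      (Matrix.of fun i j => k (s i * (s j)⁻¹) (s i • x)).PosSemidef) :
    PositiveFunctional (ρ.vectorFunctional ξ ∘ₗ ConvAlg.multiplier k) := fun a => by
  -- The factorization concerns `b b^*`; taking `b = a^*` produces `a^* a`.
  obtain ⟨n, c, hc⟩ := ConvAlg.exists_multiplier_mul_star hk (star a)
  rw [star_star] at hc
  rw [LinearMap.comp_apply, hc, map_sum]
  refine Finset.sum_nonneg fun i _ => ?_
  have h := ρ.vectorFunctional_star_mul_self ξ (star (c i))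
  rw [star_star] at h
  rw [h]
  exact Complex.zero_le_real.2 (sq_nonneg _)

/-- The GNS representation of the convolution algebra. -/
def StarRep.ofPositive {φ : ConvAlg X Γ →ₗ[ℂ] ℂ} (hφ : PositiveFunctional φ) : StarRep X Γ where
  H := Completion (PreGNS hφ)
  π := gnsRep hφ (ConvAlg.boundedMul hφ)

/-- Apply the operator of `a` to the class of `1`, whose squared norm is `φ(1)`. -/
theorem StarRep.re_le_of_positive {φ : ConvAlg X Γ →ₗ[ℂ] ℂ} (hφ : PositiveFunctional φ)
    (a : ConvAlg X Γ) :
    (φ (star a * a)).re ≤ ‖(StarRep.ofPositive hφ).π a‖ ^ 2 * (φ 1).re := by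
  have h := (gnsRep hφ (ConvAlg.boundedMul hφ) a).le_opNorm
    (PreGNS.equiv hφ 1 : Completion (PreGNS hφ))
  rw [gnsRep_apply, Completion.norm_coe, Completion.norm_coe] at h
  have h2 := pow_le_pow_left₀ (norm_nonneg _) h 2
  rwa [mul_pow, PreGNS.norm_equiv_sq, PreGNS.norm_equiv_sq, mul_one, star_one, mul_one] at h2

theorem StarRep.isDRep_ofPositive {D : Ideal (BddFun Γ)} {φ : ConvAlg X Γ →ₗ[ℂ] ℂ}
    (hφ : PositiveFunctional φ) (h : ∀ a b : ConvAlg X Γ, BelongsTo D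
      (fun s => φ (star b * (((ConvAlg.ofGroup s : unitary (ConvAlg X Γ)) : ConvAlg X Γ) * a)))) :
    StarRep.ofPositive hφ ∈ dReps X D := by
  -- The dense subspace is the image of the convolution algebra, where the coefficients are exactly
  -- `φ(b^* s a)`.
  refine ⟨LinearMap.range (Completion.toComplL (𝕜 := ℂ) (E := PreGNS hφ)).toLinearMap,
    Completion.denseRange_coe, ?_⟩
  rintro _ ⟨a, rfl⟩ _ ⟨b, rfl⟩
  obtain ⟨a, rfl⟩ := (PreGNS.equiv hφ).surjective a
  obtain ⟨b, rfl⟩ := (PreGNS.equiv hφ).surjective b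
  obtain ⟨d, hd, hds⟩ := h a b
  refine ⟨d, hd, fun s => (hds s).trans ?_⟩
  change φ _ = inner ℂ (PreGNS.equiv hφ b : Completion (PreGNS hφ))
    (gnsRep hφ (ConvAlg.boundedMul hφ) (ConvAlg.ofGroup s : unitary (ConvAlg X Γ))
      (PreGNS.equiv hφ a : Completion (PreGNS hφ)))
  rw [gnsRep_apply, Completion.inner_coe, PreGNS.inner_equiv]

/-- For `a = f t` and `b = g r` the product `b^* s a` is supported at `r⁻¹ s t`, so its value is at
most a constant times `‖k(r⁻¹ s t)‖`. Two-sided translation invariance and solidity of `D` conclude;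
sums follow by additivity. -/
theorem belongsTo_coefficient {D : Ideal (BddFun Γ)} (hD : TranslationInvariant D)
    (ρ : StarRep X Γ) (ξ : ρ.H) {k : Γ → C(X, ℂ)}
    (hk : BelongsTo D (fun s => (‖k s‖ : ℂ))) (a b : ConvAlg X Γ) :
    BelongsTo D (fun s => (ρ.vectorFunctional ξ ∘ₗ ConvAlg.multiplier k)
      (star b * (((ConvAlg.ofGroup s : unitary (ConvAlg X Γ)) : ConvAlg X Γ) * a))) := by
  induction a using ConvAlg.induction_single with
  | add a a' ha ha' => simpa only [mul_add, map_add] using ha.add ha'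
  | single t f =>
    induction b using ConvAlg.induction_single with
    | add b b' hb hb' => simpa only [star_add, add_mul, map_add] using hb.add hb'
    | single r g =>
      refine (hk.translate hD r⁻¹ t).of_norm_le (C := ‖g‖ * ‖f‖ * ‖ξ‖ ^ 2) fun s => ?_
      have hs : ((ConvAlg.ofGroup s : unitary (ConvAlg X Γ)) : ConvAlg X Γ) =
        ConvAlg.single s 1 := rfl
      rw [LinearMap.comp_apply, hs, ConvAlg.star_single, ConvAlg.single_mul_single,
        ConvAlg.single_mul_single, ConvAlg.multiplier_single, one_mul, ← mul_assoc]
      refine (ρ.norm_vectorFunctional_single_le ξ _ _).trans ?_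
      rw [Complex.norm_real, norm_norm, mul_right_comm _ (‖ξ‖ ^ 2)]
      refine mul_le_mul_of_nonneg_right ((norm_mul_le _ _).trans
        (mul_le_mul_of_nonneg_right ((norm_mul_le _ _).trans ?_) (norm_nonneg _))) (sq_nonneg _)
      exact mul_le_mul ((norm_action_le _ _).trans (norm_star g).le)
        ((norm_action_le _ _).trans (norm_action_le _ _)) (norm_nonneg _) (norm_nonneg _)

theorem tendsto_vectorFunctional_multiplier (ρ : StarRep X Γ) (ξ : ρ.H)
    {k : ℕ → Γ → C(X, ℂ)} (hk : ∀ s, Tendsto (fun n => k n s) atTop (𝓝 1)) (a : ConvAlg X Γ) :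
    Tendsto (fun n => ρ.vectorFunctional ξ (ConvAlg.multiplier (k n) a)) atTop
      (𝓝 (ρ.vectorFunctional ξ a)) := by
  induction a using ConvAlg.induction_single with
  | add a b ha hb => simpa only [map_add] using ha.add hb
  | single s f =>
    rw [tendsto_iff_norm_sub_tendsto_zero]
    have h : Tendsto (fun n => ‖f * k n s - f‖ * ‖ξ‖ ^ 2) atTop (𝓝 0) := by
      have h1 := ((hk s).const_mul f).sub_const f
      rw [mul_one, sub_self] at h1
      simpa using h1.norm.mul_const (‖ξ‖ ^ 2)
    refine squeeze_zero (fun _ => norm_nonneg _) (fun n => ?_) h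
    rw [ConvAlg.multiplier_single, ← map_sub, ← map_sub]
    exact ρ.norm_vectorFunctional_single_le ξ _ _

theorem repNorm_univ_eq_repNorm_dReps {D : Ideal (BddFun Γ)} (hD : TranslationInvariant D)
    {k : ℕ → Γ → C(X, ℂ)} (hpos : ∀ (m n : ℕ) (s : Fin n → Γ) (x : X),
      (Matrix.of fun i j => k m (s i * (s j)⁻¹) (s i • x)).PosSemidef)
    (hlim : ∀ s, Tendsto (fun n => k n s) atTop (𝓝 1))
    (hmem : ∀ n, BelongsTo D (fun s => (‖k n s‖ : ℂ))) (a : ConvAlg X Γ) :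
    repNorm Set.univ a = repNorm (dReps X D) a := by
  refine le_antisymm ?_ (repNorm_le _ (repNorm_nonneg _ a) fun ρ =>
    le_repNorm Set.univ a ⟨ρ.1, trivial⟩)
  refine repNorm_le _ (repNorm_nonneg _ a) fun ⟨ρ, _⟩ =>
    ContinuousLinearMap.opNorm_le_bound _ (repNorm_nonneg _ a) fun ξ => ?_
  refine le_of_sq_le_sq ?_ (mul_nonneg (repNorm_nonneg _ a) (norm_nonneg _))
  have h : ∀ n, (ρ.vectorFunctional ξ (ConvAlg.multiplier (k n) (star a * a))).re ≤
      repNorm (dReps X D) a ^ 2 * (ρ.vectorFunctional ξ (ConvAlg.multiplier (k n) 1)).re := by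
    intro n
    have hφ := positiveFunctional_vectorFunctional_comp_multiplier ρ ξ (hpos n)
    refine (StarRep.re_le_of_positive hφ a).trans (mul_le_mul_of_nonneg_right ?_ ?_)
    -- The GNS representation of the multiplied functional is one of those over which the ideal
    -- seminorm is a supremum.
    · exact pow_le_pow_left₀ (norm_nonneg _) (le_repNorm (dReps X D) a
        ⟨_, StarRep.isDRep_ofPositive hφ (belongsTo_coefficient hD ρ ξ (hmem n))⟩) 2
    · simpa using (Complex.le_def.1 (hφ 1)).1
  -- The multiplied functionals are not normalized: their values at `1` only tend to `‖ξ‖²`, so both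
  -- sides pass to the limit.
  have hl := le_of_tendsto_of_tendsto'
    ((Complex.continuous_re.tendsto _).comp
      (tendsto_vectorFunctional_multiplier ρ ξ hlim (star a * a)))
    (((Complex.continuous_re.tendsto _).comp
      (tendsto_vectorFunctional_multiplier ρ ξ hlim 1)).const_mul _) h
  have h1 := ρ.vectorFunctional_star_mul_self ξ 1
  rw [star_one, mul_one, map_one ρ.π, one_apply_eq_self] at h1
  rwa [ρ.vectorFunctional_star_mul_self, h1, Complex.ofReal_re, Complex.ofReal_re,
    ← mul_pow] at hl

end Comparison

/-! ### Completions with respect to equal seminorms -/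

section Completion

open UniformSpace

variable {X : Type u} {Γ : Type v} [TopologicalSpace X] [CompactSpace X] [Group Γ]
  [MulAction Γ X] [ContinuousConstSMul Γ X] {S T : Set (StarRep X Γ)}

namespace CStarCompletion

/-- The identity of `C_c(X ⋊ Γ)` as a map between seminormed algebras. -/
def preMap (S T : Set (StarRep X Γ)) : PreCStar S →+* PreCStar T := RingHom.id (ConvAlg X Γ)

theorem continuous_preMap (h : ∀ a : ConvAlg X Γ, repNorm S a = repNorm T a) :
    Continuous (preMap S T) :=
  have hn : ∀ a : PreCStar S, ‖preMap S T a‖ = ‖a‖ := fun a => (h a).symm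
  (AddMonoidHomClass.isometry_of_norm (preMap S T) hn).continuous

/-- The map between completions induced by the identity of `C_c(X ⋊ Γ)`. -/
def map (h : ∀ a : ConvAlg X Γ, repNorm S a = repNorm T a) :
    CStarCompletion S →+* CStarCompletion T :=
  Completion.mapRingHom (preMap S T) (continuous_preMap h)

variable (h : ∀ a : ConvAlg X Γ, repNorm S a = repNorm T a)

theorem map_of (a : ConvAlg X Γ) : map h (of S a) = of T a :=
  Completion.mapRingHom_coe (continuous_preMap h) a

theorem continuous_map : Continuous (map h) :=
  Completion.continuous_map (f := preMap S T)

theorem of_induction {p : CStarCompletion S → Prop} (x : CStarCompletion S)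
    (hp : IsClosed {x | p x}) (h : ∀ a, p (of S a)) : p x := induction S x hp h

theorem map_map (x : CStarCompletion S) : map (fun a => (h a).symm) (map h x) = x := by
  induction x using of_induction with
  | hp => exact isClosed_eq ((continuous_map _).comp (continuous_map h)) continuous_id
  | h a => rw [map_of, map_of]

theorem norm_map (x : CStarCompletion S) : ‖map h x‖ = ‖x‖ := by
  induction x using of_induction with
  | hp => exact isClosed_eq (continuous_map h).norm continuous_norm
  | h a => rw [map_of, norm_of, norm_of, h]

/-- Equal seminorms on `C_c(X ⋊ Γ)` have isomorphic completions. -/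
def congr : CStarCompletion S ≃⋆ₐ[ℂ] CStarCompletion T where
  toFun := map h
  invFun := map fun a => (h a).symm
  left_inv := map_map h
  right_inv := map_map fun a => (h a).symm
  map_mul' := map_mul _
  map_add' := map_add _
  map_star' x := by
    have hS := continuous_star S
    have hT := continuous_star T
    have hm := continuous_map h
    induction x using of_induction with
    | hp => exact isClosed_eq (hm.comp hS) (hT.comp hm)
    | h a => rw [← map_star, map_of, map_of, map_star]
  map_smul' c x := by
    have hm := continuous_map h
    induction x using of_induction with
    | hp => exact isClosed_eq (hm.comp (continuous_const_smul c)) (hm.const_smul c)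
    | h a => rw [← map_smul, map_of, map_of, map_smul]

theorem congr_of (a : ConvAlg X Γ) : congr h (of S a) = of T a := map_of h a

theorem isometry_congr : Isometry (congr h) :=
  AddMonoidHomClass.isometry_of_norm (map h) (norm_map h)

end CStarCompletion

end Completion

end CrossedProduct

end

theorem mainTheorem4 {X Γ : Type*} [TopologicalSpace X] [CompactSpace X] [T2Space X]
    [Group Γ] [TopologicalSpace Γ] [DiscreteTopology Γ]
    [MulAction Γ X] [ContinuousConstSMul Γ X]
    (D : Ideal (BddFun Γ)) (hD : TranslationInvariant D)
    (h : ℕ → C(X × Γ, ℂ))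
    (hpos : ∀ n, PositiveDefinite (h n))
    (hlim : ∀ K : Set (X × Γ), IsCompact K →
      TendstoUniformlyOn (fun n p => h n p) (fun _ => 1) Filter.atTop K)
    (hmem : ∀ n, BelongsTo D (fun s => (‖slice (h n) s‖ : ℂ))) :
    ∃ Φ : FullCrossedProduct X Γ ≃⋆ₐ[ℂ] IdealCrossedProduct X D,
      Isometry Φ ∧ ∀ a : ConvAlg X Γ, Φ (toFull X Γ a) = toIdeal X D a := by
  have hk : ∀ s, Filter.Tendsto (fun n => slice (h n) s) Filter.atTop (nhds 1) := fun s => by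
    rw [ContinuousMap.tendsto_iff_tendstoUniformly, Metric.tendstoUniformly_iff]
    intro ε hε
    have hK := Metric.tendstoUniformlyOn_iff.1
      -- As `X` is compact, `X × {s}` is an admissible compact set, and uniform convergence there is
      -- norm convergence in `C(X)`.
      (hlim (Set.univ ×ˢ {s}) (isCompact_univ.prod isCompact_singleton)) ε hε
    filter_upwards [hK] with n hn x
    exact hn (x, s) ⟨trivial, rfl⟩
  have hnorm := repNorm_univ_eq_repNorm_dReps hD (k := fun n => slice (h n)) hpos hk hmem
  exact ⟨CStarCompletion.congr hnorm, CStarCompletion.isometry_congr hnorm,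
    CStarCompletion.congr_of hnorm⟩
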